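/- A \emph{Gauss diagram} is a finite set of signed arrows (sign $\pm1$) with pairwise distinct endpoints on an oriented circle (for knots) or on an oriented line (for long knots), considered up to orientation-preserving homeomorphism of the circle or line. \emph{Virtual knots} and \emph{long virtual knots} are the equivalence classes of Gauss diagrams on the circle, respectively on the line, under the three Reidemeister moves; arrows stand for classical crossings and point from the overpass to the underpass, signs are the local writhes, and virtual crossings are not recorded. A \emph{virtualization move} reverses the direction of one arrow of a Gauss diagram and keeps its sign. Let $G$ be a torsion-free abelian group (for example $\mathbb{Z}$ or $\mathbb{Q}$), and let $v$ be a $G$-valued function on the set of virtual knots, or on the set of long virtual knots. It is extended to Gauss diagrams some of whose arrows are dashed (semivirtual crossings) by setting the value of a dashed arrow to be the value with the arrow present minus the value with the arrow deleted. That is, for a Gauss diagram $D$ and a set $S$ of arrows of $D$, $$v(D,S)=\sum_{T\subseteq S}(-1)^{|T|}\,v(D\smallsetminus T).$$ The invariant $v$ is \emph{of GPV (Goussarov--Polyak--Viro) finite type} if there is an $n$ such that $v(D,S)=0$ whenever $|S|>n$. \textbf{Theorem.} Let $v$ be a $G$-valued GPV finite-type invariant of virtual knots or of long virtual knots. If $v(K)=v(K')$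 whenever $K$ and $K'$ are obtained from one another by a virtualization move, then $v$ is constant. More specifically, if $v$ is not constant, then there are knots (respectively long knots) $K$ and $K'$ that are obtained from one another by a single virtualization move and satisfy $v(K)\neq v(K')$. -/

import Mathlib

namespace VirtualKnots

/-- An arrow of a Gauss diagram: a label (its name) together with its sign `±1`, the local
writhe of the classical crossing that it stands for. -/
@[ext] structure Arrow where
  label : ℕ
  sign : ℤˣ
  deriving DecidableEq

/-- The two ends of an arrow. The `tail` is on the overpassing arc of the crossing, the `head`
is on the underpassing arc. -/
inductive ArrowEnd
  | tail
  | head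
  deriving DecidableEq

/-- The other end of an arrow. -/
def ArrowEnd.flip : ArrowEnd → ArrowEnd
  | .tail => .head
  | .head => .tail

/-- A marked point of the Wilson loop or Wilson line: one of the two ends of an arrow. -/
@[ext] structure Endpoint where
  arrow : Arrow
  side : ArrowEnd
  deriving DecidableEq

/-- The other endpoint of the same arrow. -/
def Endpoint.flip (x : Endpoint) : Endpoint := ⟨x.arrow, x.side.flip⟩

/-- A Gauss diagram, presented by the word of the endpoints of its arrows in the order in which
they are met along the oriented Wilson line (or along the oriented Wilson loop, starting from some
point that is not an endpoint). Every arrow that occurs has its tail and its head exactly once. -/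
@[ext] structure GaussDiagram where
  word : List Endpoint
  nodup : word.Nodup
  flip_mem : ∀ x ∈ word, x.flip ∈ word

namespace GaussDiagram

/-- The set of arrows of a Gauss diagram. -/
def arrows (D : GaussDiagram) : Finset Arrow := (D.word.map Endpoint.arrow).toFinset

/-- The subdiagram obtained by deleting the arrows in `T`; in terms of knot diagrams, the
corresponding classical crossings are made virtual. -/
def delete (D : GaussDiagram) (T : Finset Arrow) : GaussDiagram where
  word := D.word.filter fun x => x.arrow ∉ T
  nodup := D.nodup.filter _
  flip_mem := by
    intro x hx
    rw [List.mem_filter] at hx ⊢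
    exact ⟨D.flip_mem x hx.1, hx.2⟩

/-- Exchange head and tail of the arrow `a`, at a single endpoint. -/
def reverseEndpoint (a : Arrow) (x : Endpoint) : Endpoint := if x.arrow = a then x.flip else x

theorem reverseEndpoint_involutive (a : Arrow) : Function.Involutive (reverseEndpoint a) := by
  rintro ⟨b, e⟩
  by_cases h : b = a <;> cases e <;> simp [reverseEndpoint, Endpoint.flip, ArrowEnd.flip, h]

theorem reverseEndpoint_flip (a : Arrow) (x : Endpoint) :
    (reverseEndpoint a x).flip = reverseEndpoint a x.flip := by
  by_cases h : x.arrow = a <;> simp [reverseEndpoint, Endpoint.flip, h]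

/-- The diagram obtained by reversing the direction of the arrow `a` and keeping its sign. -/
def reverseArrow (D : GaussDiagram) (a : Arrow) : GaussDiagram where
  word := D.word.map (reverseEndpoint a)
  nodup := D.nodup.map (reverseEndpoint_involutive a).injective
  flip_mem := by
    intro x hx
    obtain ⟨y, hy, rfl⟩ := List.mem_map.1 hx
    rw [reverseEndpoint_flip]
    exact List.mem_map_of_mem (D.flip_mem y hy)

end GaussDiagram

/-- Change the names of the arrows of an endpoint. -/
def Endpoint.relabel (f : Arrow ≃ Arrow) (x : Endpoint) : Endpoint := ⟨f x.arrow, x.side⟩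

/-- The list `l` if `τ = 1`, the reversed list if `τ = -1`. -/
def oriented (τ : ℤˣ) (l : List Endpoint) : List Endpoint := if τ = 1 then l else l.reverse

/-- The elementary moves on words of endpoints along an oriented line: changing the names of the
arrows, and the three Reidemeister moves (with all choices of directions, signs and positions on
the line). The detour move and the moves of virtual crossings do not change the Gauss diagram. -/
inductive Move : List Endpoint → List Endpoint → Prop
  /-- Renaming the arrows without changing their signs. -/
  | relabel (f : Arrow ≃ Arrow) (hf : ∀ a, (f a).sign = a.sign) (w : List Endpoint) :
      Move w (w.map (Endpoint.relabel f))
  /-- The first Reidemeister move deletes an arrow with adjacent endpoints. -/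
  | r1 (u t : List Endpoint) (x : Endpoint) :
      Move (u ++ [x, x.flip] ++ t) (u ++ t)
  /-- The second Reidemeister move deletes two arrows of opposite signs, the two tails of which
  are adjacent and the two heads of which are adjacent; the two strands may run in the same
  direction (`τ = 1`) or in opposite directions (`τ = -1`). -/
  | r2 (u t s : List Endpoint) (a b : Arrow) (e : ArrowEnd) (τ : ℤˣ) (hs : a.sign = -b.sign) :
      Move (u ++ [⟨a, e⟩, ⟨b, e⟩] ++ t ++ oriented τ [⟨a, e.flip⟩, ⟨b, e.flip⟩] ++ s)
        (u ++ t ++ s)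
  /-- The third Reidemeister move. Strand 1 is on top, strand 2 in the middle, strand 3 at the
  bottom; `a`, `b`, `c` are the crossings of the strands 1 and 2, 1 and 3, 2 and 3. The two
  endpoints on each strand are exchanged. The numbers `τ₁ τ₂ τ₃` say in which order the two
  crossings are met on each strand. The strands may come in any order (`hp`). The condition on
  signs says that the three crossings are those of three oriented lines in the plane. -/
  | r3 (u₀ u₁ u₂ u₃ p q r : List Endpoint) (a b c : Arrow) (σ τ₁ τ₂ τ₃ : ℤˣ)
      (ha : a.sign = σ * τ₁ * τ₂) (hb : b.sign = σ * τ₁ * τ₃) (hc : c.sign = σ * τ₂ * τ₃)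
      (hp : List.Perm [p, q, r]
        [oriented τ₁ [⟨a, .tail⟩, ⟨b, .tail⟩],
         oriented τ₂ [⟨a, .head⟩, ⟨c, .tail⟩],
         oriented τ₃ [⟨b, .head⟩, ⟨c, .head⟩]]) :
      Move (u₀ ++ p ++ u₁ ++ q ++ u₂ ++ r ++ u₃)
        (u₀ ++ p.reverse ++ u₁ ++ q.reverse ++ u₂ ++ r.reverse ++ u₃)

/-- One elementary move between Gauss diagrams on the Wilson line. -/
def LongStep (D D' : GaussDiagram) : Prop := Move D.word D'.word

/-- One elementary move between Gauss diagrams on the Wilson loop: a move as on the line, or a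
change of the point at which the reading of the circular word starts. -/
def ClosedStep (D D' : GaussDiagram) : Prop := Move D.word D'.word ∨ D.word ~r D'.word

/-- Virtual isotopy of Gauss diagrams on the Wilson line. -/
def longSetoid : Setoid GaussDiagram := Relation.EqvGen.setoid LongStep

/-- Virtual isotopy of Gauss diagrams on the Wilson loop. -/
def closedSetoid : Setoid GaussDiagram := Relation.EqvGen.setoid ClosedStep

/-- Long virtual knots (oriented, up to virtual isotopy). -/
def LongVirtualKnot : Type := Quotient longSetoid

/-- Virtual knots (oriented, up to virtual isotopy). -/
def VirtualKnot : Type := Quotient closedSetoid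

/-- The long virtual knot with a given Gauss diagram. -/
def LongVirtualKnot.mk (D : GaussDiagram) : LongVirtualKnot := Quotient.mk longSetoid D

/-- The virtual knot with a given Gauss diagram. -/
def VirtualKnot.mk (D : GaussDiagram) : VirtualKnot := Quotient.mk closedSetoid D

/-- The long virtual knots `K` and `K'` have diagrams that differ by one virtualization move: the
direction of one arrow is reversed and its sign is kept. -/
def LongVirtualKnot.Virtualization (K K' : LongVirtualKnot) : Prop :=
  ∃ D : GaussDiagram, ∃ a ∈ D.arrows,
    K = LongVirtualKnot.mk D ∧ K' = LongVirtualKnot.mk (D.reverseArrow a)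

/-- The virtual knots `K` and `K'` have diagrams that differ by one virtualization move: the
direction of one arrow is reversed and its sign is kept. -/
def VirtualKnot.Virtualization (K K' : VirtualKnot) : Prop :=
  ∃ D : GaussDiagram, ∃ a ∈ D.arrows,
    K = VirtualKnot.mk D ∧ K' = VirtualKnot.mk (D.reverseArrow a)

/-- The value of a function `v` of diagrams on the diagram `D` in which the crossings in `S` are
semivirtual, i.e. the arrows in `S` are dashed: a semivirtual crossing is the difference of the
classical crossing and the virtual one. -/
def semivirtualValue {G : Type*} [AddCommGroup G] (v : GaussDiagram → G) (D : GaussDiagram)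
    (S : Finset Arrow) : G :=
  ∑ T ∈ S.powerset, (-1 : ℤ) ^ T.card • v (D.delete T)

/-- The function `v` of diagrams vanishes on all diagrams with more than `n` semivirtual
crossings. -/
def VanishesAbove {G : Type*} [AddCommGroup G] (n : ℕ) (v : GaussDiagram → G) : Prop :=
  ∀ (D : GaussDiagram) (S : Finset Arrow), S ⊆ D.arrows → n < S.card → semivirtualValue v D S = 0

/-- Goussarov-Polyak-Viro finite-type invariants of long virtual knots. -/
def LongVirtualKnot.IsGPVFiniteType {G : Type*} [AddCommGroup G] (v : LongVirtualKnot → G) :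
    Prop :=
  ∃ n : ℕ, VanishesAbove n fun D => v (LongVirtualKnot.mk D)

/-- Goussarov-Polyak-Viro finite-type invariants of virtual knots. -/
def VirtualKnot.IsGPVFiniteType {G : Type*} [AddCommGroup G] (v : VirtualKnot → G) : Prop :=
  ∃ n : ℕ, VanishesAbove n fun D => v (VirtualKnot.mk D)

end VirtualKnots

/-! ### Words of endpoints: arrows, deletion, reversal. -/

namespace VirtualKnots

open GaussDiagram

/-! The invariant is studied through its values on diagrams with all arrows dashed (`allDashed`).
Finite type says that these vanish on diagrams with more than `n` arrows. The threshold is lowered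
one unit at a time until the value vanishes on every nonempty diagram (`allDashed_eq_zero`);
inclusion-exclusion then shows that every diagram has the value of the empty one
(`eq_nil_of_allDashed_eq_zero`).

For one such step, let the fully dashed value vanish above `N > 0` arrows and consider diagrams with
`N` arrows. There the Reidemeister moves become linear relations. The first move kills diagrams with
an isolated arrow (`allDashed_isolated`). The second says that changing the sign of an arrow negates
the value (`allDashed_parallel`), and virtualization says that changing its direction does nothing.
The third gives a six-term relation among subdiagrams that contain two of the three arrows
(`allDashed_six_term`).

The main point is `allDashed_corner`. The arrow `c` of a third move, opposite the corner of two
adjacent tails, may be replaced by an arrow of opposite sign and direction, and this is again a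
third move. The terms that contain `c` change sign and the terms without it do not. Adding the two
relations leaves twice the statement that the adjacent tails may be exchanged, and `G` has no
torsion. With virtualization any two adjacent endpoints of distinct arrows commute
(`allDashed_comm`), so an arrow can be shrunk until it is isolated, and the value is zero. -/

@[simp] theorem ArrowEnd.flip_flip (e : ArrowEnd) : e.flip.flip = e := by cases e <;> rfl

@[simp] theorem Endpoint.flip_flip (x : Endpoint) : x.flip.flip = x := by
  simp [Endpoint.flip]

@[simp] theorem Endpoint.flip_arrow (x : Endpoint) : x.flip.arrow = x.arrow := rfl

theorem Endpoint.eq_or_eq_flip {x y : Endpoint} (h : y.arrow = x.arrow) : y = x ∨ y = x.flip := by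
  obtain ⟨a, e⟩ := x
  obtain ⟨b, e'⟩ := y
  obtain rfl : b = a := h
  cases e <;> cases e' <;> simp [Endpoint.flip, ArrowEnd.flip]

theorem Endpoint.flip_ne (x : Endpoint) : x.flip ≠ x := by
  obtain ⟨a, e⟩ := x
  cases e <;> simp [Endpoint.flip, ArrowEnd.flip]

/-- The words of endpoints that present Gauss diagrams. -/
structure IsGaussWord (w : List Endpoint) : Prop where
  nodup : w.Nodup
  flip_mem : ∀ x ∈ w, x.flip ∈ w

/-- The arrows that occur in a word of endpoints. -/
def wordArrows (w : List Endpoint) : Finset Arrow := (w.map Endpoint.arrow).toFinset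

/-- Delete all endpoints of the arrows in `T` from a word. -/
def deleteArrows (T : Finset Arrow) (w : List Endpoint) : List Endpoint :=
  w.filter fun x => x.arrow ∉ T

theorem mem_wordArrows {w : List Endpoint} {a : Arrow} :
    a ∈ wordArrows w ↔ ∃ x ∈ w, x.arrow = a := by
  simp [wordArrows]

@[simp] theorem wordArrows_nil : wordArrows [] = ∅ := rfl

@[simp] theorem wordArrows_cons (x : Endpoint) (w : List Endpoint) :
    wordArrows (x :: w) = insert x.arrow (wordArrows w) := by
  ext a
  simp [wordArrows]

@[simp] theorem wordArrows_append (u v : List Endpoint) :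
    wordArrows (u ++ v) = wordArrows u ∪ wordArrows v := by
  ext a
  simp [wordArrows]

theorem wordArrows_perm {u v : List Endpoint} (h : u.Perm v) : wordArrows u = wordArrows v := by
  ext a
  simp only [mem_wordArrows, h.mem_iff]

theorem wordArrows_deleteArrows (T : Finset Arrow) (w : List Endpoint) :
    wordArrows (deleteArrows T w) = wordArrows w \ T := by
  ext a
  simp only [mem_wordArrows, deleteArrows, List.mem_filter, Finset.mem_sdiff, decide_eq_true_eq]
  constructor
  · rintro ⟨x, ⟨h, h'⟩, rfl⟩
    exact ⟨⟨x, h, rfl⟩, h'⟩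
  · rintro ⟨⟨x, h, rfl⟩, h'⟩
    exact ⟨x, ⟨h, h'⟩, rfl⟩

@[simp] theorem deleteArrows_nil (T : Finset Arrow) : deleteArrows T [] = [] := rfl

@[simp] theorem deleteArrows_append (T : Finset Arrow) (u v : List Endpoint) :
    deleteArrows T (u ++ v) = deleteArrows T u ++ deleteArrows T v := by
  simp [deleteArrows]

theorem deleteArrows_cons (T : Finset Arrow) (x : Endpoint) (w : List Endpoint) :
    deleteArrows T (x :: w) =
      if x.arrow ∈ T then deleteArrows T w else x :: deleteArrows T w := by
  by_cases h : x.arrow ∈ T <;> simp [deleteArrows, h]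

theorem deleteArrows_eq_self {T : Finset Arrow} {w : List Endpoint}
    (h : Disjoint T (wordArrows w)) : deleteArrows T w = w := by
  rw [deleteArrows, List.filter_eq_self]
  intro x hx
  simpa using fun hT => Finset.disjoint_left.1 h hT (mem_wordArrows.2 ⟨x, hx, rfl⟩)

theorem deleteArrows_singleton_eq_self {a : Arrow} {w : List Endpoint}
    (h : a ∉ wordArrows w) : deleteArrows {a} w = w :=
  deleteArrows_eq_self (by simpa using h)

theorem deleteArrows_deleteArrows (T T' : Finset Arrow) (w : List Endpoint) :
    deleteArrows T (deleteArrows T' w) = deleteArrows (T' ∪ T) w := by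
  simp only [deleteArrows, List.filter_filter]
  congr 1
  ext x
  simp [and_comm]

theorem deleteArrows_wordArrows (w : List Endpoint) : deleteArrows (wordArrows w) w = [] := by
  rw [deleteArrows, List.filter_eq_nil_iff]
  intro x hx
  simpa using mem_wordArrows.2 ⟨x, hx, rfl⟩

theorem deleteArrows_map {g : Endpoint → Endpoint} {T : Finset Arrow} {w : List Endpoint}
    (h : ∀ x ∈ w, ((g x).arrow ∈ T ↔ x.arrow ∈ T)) :
    deleteArrows T (w.map g) = (deleteArrows T w).map g := by
  rw [deleteArrows, deleteArrows, List.filter_map]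
  congr 1
  apply List.filter_congr
  intro x hx
  simp [h x hx]

@[simp] theorem reverseEndpoint_arrow (a : Arrow) (x : Endpoint) :
    (reverseEndpoint a x).arrow = x.arrow := by
  by_cases h : x.arrow = a <;> simp [reverseEndpoint, h]

theorem wordArrows_map_reverse (a : Arrow) (w : List Endpoint) :
    wordArrows (w.map (reverseEndpoint a)) = wordArrows w := by
  ext b
  simp [mem_wordArrows]

theorem map_reverse_eq_self {a : Arrow} {w : List Endpoint} (h : a ∉ wordArrows w) :
    w.map (reverseEndpoint a) = w := by
  refine (List.map_congr_left fun x hx => ?_).trans (List.map_id w)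
  rw [reverseEndpoint, if_neg, id]
  exact fun hxa => h (mem_wordArrows.2 ⟨x, hx, hxa⟩)

namespace IsGaussWord

theorem delete {w : List Endpoint} (h : IsGaussWord w) (T : Finset Arrow) :
    IsGaussWord (deleteArrows T w) :=
  let D : GaussDiagram := GaussDiagram.delete ⟨w, h.1, h.2⟩ T
  ⟨D.nodup, D.flip_mem⟩

theorem map_reverse {w : List Endpoint} (h : IsGaussWord w) (a : Arrow) :
    IsGaussWord (w.map (reverseEndpoint a)) :=
  let D : GaussDiagram := GaussDiagram.reverseArrow ⟨w, h.1, h.2⟩ a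
  ⟨D.nodup, D.flip_mem⟩

theorem perm {w w' : List Endpoint} (h : IsGaussWord w) (hp : w.Perm w') : IsGaussWord w' :=
  ⟨hp.nodup_iff.1 h.1, fun x hx => hp.mem_iff.1 (h.2 x (hp.mem_iff.2 hx))⟩

theorem insert {w : List Endpoint} (h : IsGaussWord w) {x : Endpoint}
    (hx : x.arrow ∉ wordArrows w) : IsGaussWord (x :: x.flip :: w) := by
  have h1 : ∀ y ∈ w, y.arrow ≠ x.arrow := fun y hy he => hx (mem_wordArrows.2 ⟨y, hy, he⟩)
  refine ⟨?_, ?_⟩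
  · simp only [List.nodup_cons, List.mem_cons, not_or]
    exact ⟨⟨x.flip_ne.symm, fun hm => h1 _ hm rfl⟩, fun hm => h1 _ hm rfl, h.1⟩
  · intro y hy
    simp only [List.mem_cons] at hy ⊢
    rcases hy with rfl | rfl | hy
    · simp
    · simp
    · exact .inr (.inr (h.2 y hy))

theorem arrow_notMem {w w' : List Endpoint} {x : Endpoint} (h : IsGaussWord w')
    (hp : w'.Perm (x :: x.flip :: w)) : x.arrow ∉ wordArrows w := by
  intro hx
  obtain ⟨y, hy, hxy⟩ := mem_wordArrows.1 hx
  have h1 := hp.nodup_iff.1 h.1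
  simp only [List.nodup_cons, List.mem_cons, not_or] at h1
  rcases Endpoint.eq_or_eq_flip hxy with rfl | rfl
  · exact h1.1.2 hy
  · exact h1.2.1 hy

theorem of_insert {w w' : List Endpoint} {x : Endpoint} (h : IsGaussWord w')
    (hp : w'.Perm (x :: x.flip :: w)) : IsGaussWord w := by
  have h1 := h.arrow_notMem hp
  have h2 := (h.perm hp).delete {x.arrow}
  rwa [deleteArrows_cons, deleteArrows_cons, if_pos (by simp), if_pos (by simp),
    deleteArrows_singleton_eq_self h1] at h2

end IsGaussWord

/-! ### Dashed arrows, and the relations from the Reidemeister moves. -/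

section Semivirtual

variable {G : Type*} [AddCommGroup G]

/-- The value on a word in which the arrows in `S` are dashed. -/
def wordSemivirtual (V : List Endpoint → G) (w : List Endpoint) (S : Finset Arrow) : G :=
  ∑ T ∈ S.powerset, (-1 : ℤ) ^ T.card • V (deleteArrows T w)

/-- The value on a word in which all arrows are dashed. -/
def allDashed (V : List Endpoint → G) (w : List Endpoint) : G :=
  wordSemivirtual V w (wordArrows w)

theorem wordSemivirtual_insert (V : List Endpoint → G) (w : List Endpoint) {a : Arrow}
    {S : Finset Arrow} (ha : a ∉ S) :
    wordSemivirtual V w (insert a S) =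
      wordSemivirtual V w S - wordSemivirtual V (deleteArrows {a} w) S := by
  simp only [wordSemivirtual]
  rw [Finset.sum_powerset_insert ha, sub_eq_add_neg, ← Finset.sum_neg_distrib]
  congr 1
  apply Finset.sum_congr rfl
  intro T hT
  have haT : a ∉ T := fun h => ha (Finset.mem_powerset.1 hT h)
  rw [Finset.card_insert_of_notMem haT, pow_succ, deleteArrows_deleteArrows,
    ← Finset.insert_eq]
  simp

theorem wordSemivirtual_congr {V : List Endpoint → G} {w w' : List Endpoint} {S : Finset Arrow}
    (h : ∀ T ⊆ S, V (deleteArrows T w) = V (deleteArrows T w')) :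
    wordSemivirtual V w S = wordSemivirtual V w' S :=
  Finset.sum_congr rfl fun T hT => by rw [h T (Finset.mem_powerset.1 hT)]

/-- Functions on words that are invariant under virtual isotopy and virtualization. -/
structure IsInvariant (V : List Endpoint → G) : Prop where
  move : ∀ {w w'}, IsGaussWord w → IsGaussWord w' → Move w w' → V w = V w'
  reverse : ∀ {w} (a : Arrow), IsGaussWord w → V (w.map (reverseEndpoint a)) = V w

variable {V : List Endpoint → G}

theorem allDashed_map_reverse (hV : IsInvariant V) {w : List Endpoint} (hw : IsGaussWord w)
    (a : Arrow) : allDashed V (w.map (reverseEndpoint a)) = allDashed V w := by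
  rw [allDashed, allDashed, wordArrows_map_reverse]
  apply wordSemivirtual_congr
  intro T _
  rw [deleteArrows_map (by simp), hV.reverse a (hw.delete T)]

/-- Dashing the isolated arrow gives a difference of two values that the first Reidemeister move
identifies, whichever other arrows are deleted. -/
theorem allDashed_isolated (hV : IsInvariant V) {u t : List Endpoint} {x : Endpoint}
    (hw : IsGaussWord (u ++ [x, x.flip] ++ t)) : allDashed V (u ++ [x, x.flip] ++ t) = 0 := by
  have hp : (u ++ [x, x.flip] ++ t).Perm (x :: x.flip :: (u ++ t)) := by
    rw [List.perm_iff_count]; intro y; simp [List.count_cons]; omega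
  have hx := hw.arrow_notMem hp
  have hut := hw.of_insert hp
  have hA : wordArrows (u ++ [x, x.flip] ++ t) = insert x.arrow (wordArrows (u ++ t)) := by
    rw [wordArrows_perm hp]; simp
  have hd : deleteArrows {x.arrow} (u ++ [x, x.flip] ++ t) = u ++ t := by
    rw [← deleteArrows_singleton_eq_self hx]
    simp [deleteArrows_cons]
  rw [allDashed, hA, wordSemivirtual_insert _ _ hx, hd, sub_eq_zero]
  apply wordSemivirtual_congr
  intro T hT
  have hxT : x.arrow ∉ T := fun h => hx (hT h)
  have h1 := hw.delete T
  have h2 := hut.delete T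
  simp only [deleteArrows_append, deleteArrows_cons, Endpoint.flip_arrow, hxT, if_false,
    deleteArrows_nil] at h1 h2 ⊢
  exact hV.move h1 h2 (Move.r1 _ _ _)

/-- Replace the arrow `a` by `b`. -/
def replaceArrow (a b : Arrow) (x : Endpoint) : Endpoint :=
  if x.arrow = a then ⟨b, x.side⟩ else x

theorem map_replaceArrow_eq_self {a b : Arrow} {w : List Endpoint} (h : a ∉ wordArrows w) :
    w.map (replaceArrow a b) = w := by
  refine (List.map_congr_left fun x hx => ?_).trans (List.map_id w)
  rw [replaceArrow, if_neg, id]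
  exact fun hxa => h (mem_wordArrows.2 ⟨x, hx, hxa⟩)

/-- Take the diagram with both arrows, side by side. With all arrows dashed it is zero by `hN`.
Expanding only `a` and `b`, the term with both equals the term with neither by the second
Reidemeister move, and what remains is minus the sum of the two fully dashed values in question. -/
theorem allDashed_parallel (hV : IsInvariant V) {u t s : List Endpoint} {a b : Arrow}
    {e : ArrowEnd} (hs : a.sign = -b.sign)
    (hw : IsGaussWord (u ++ [⟨a, e⟩] ++ t ++ [⟨a, e.flip⟩] ++ s))
    (hb : b ∉ wordArrows (u ++ [⟨a, e⟩] ++ t ++ [⟨a, e.flip⟩] ++ s))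
    (hN : ∀ w', IsGaussWord w' →
      (wordArrows (u ++ [⟨a, e⟩] ++ t ++ [⟨a, e.flip⟩] ++ s)).card < (wordArrows w').card →
      allDashed V w' = 0) :
    allDashed V (u ++ [⟨b, e⟩] ++ t ++ [⟨b, e.flip⟩] ++ s) =
      -allDashed V (u ++ [⟨a, e⟩] ++ t ++ [⟨a, e.flip⟩] ++ s) := by
  have hp : List.Perm (u ++ [⟨a, e⟩] ++ t ++ [⟨a, e.flip⟩] ++ s)
      ((⟨a, e⟩ : Endpoint) :: (⟨a, e⟩ : Endpoint).flip :: (u ++ t ++ s)) := by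
    rw [List.perm_iff_count]; intro y; simp [List.count_cons, Endpoint.flip]; omega
  have ha : a ∉ wordArrows (u ++ t ++ s) := hw.arrow_notMem hp
  have h0 := hw.of_insert hp
  have hab : b ≠ a := by
    rintro rfl
    simp at hb
  have hb' : b ∉ wordArrows (u ++ t ++ s) := by
    simp only [wordArrows_append, Finset.mem_union, not_or] at hb ⊢
    tauto
  have hP : IsGaussWord
      (u ++ [⟨a, e⟩, ⟨b, e⟩] ++ t ++ oriented 1 [⟨a, e.flip⟩, ⟨b, e.flip⟩] ++ s) := by
    refine (hw.insert (x := ⟨b, e⟩) hb).perm ?_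
    rw [List.perm_iff_count]; intro y; simp [List.count_cons, Endpoint.flip, oriented]; omega
  set W := u ++ [⟨a, e⟩, ⟨b, e⟩] ++ t ++ oriented 1 [⟨a, e.flip⟩, ⟨b, e.flip⟩] ++ s with hW
  set S := wordArrows (u ++ t ++ s) with hS
  have hAa : wordArrows (u ++ [⟨a, e⟩] ++ t ++ [⟨a, e.flip⟩] ++ s) = insert a S := by
    rw [wordArrows_perm hp]; simp [Endpoint.flip, hS]
  have hAb : wordArrows (u ++ [⟨b, e⟩] ++ t ++ [⟨b, e.flip⟩] ++ s) = insert b S := by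
    ext; simp [hS]
  have hAW : wordArrows W = insert b (insert a S) := by
    ext; simp [hW, hS, oriented]; tauto
  have hbS : b ∉ insert a S := by simp [hab, hb']
  have h1 := hN W hP (by rw [hAW, hAa, Finset.card_insert_of_notMem hbS]; omega)
  have hu : deleteArrows {a} u = u ∧ deleteArrows {a} t = t ∧ deleteArrows {a} s = s := by
    simp only [hS, wordArrows_append, Finset.mem_union, not_or] at ha
    exact ⟨deleteArrows_singleton_eq_self ha.1.1, deleteArrows_singleton_eq_self ha.1.2,
      deleteArrows_singleton_eq_self ha.2⟩
  have hu' : deleteArrows {b} u = u ∧ deleteArrows {b} t = t ∧ deleteArrows {b} s = s := by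
    simp only [hS, wordArrows_append, Finset.mem_union, not_or] at hb'
    exact ⟨deleteArrows_singleton_eq_self hb'.1.1, deleteArrows_singleton_eq_self hb'.1.2,
      deleteArrows_singleton_eq_self hb'.2⟩
  have hWS : wordSemivirtual V W S = wordSemivirtual V (u ++ t ++ s) S := by
    apply wordSemivirtual_congr
    intro T hT
    have haT : a ∉ T := fun h => ha (hT h)
    have hbT : b ∉ T := fun h => hb' (hT h)
    have h1 := hP.delete T
    have h2 := h0.delete T
    simp only [hW, oriented, if_true, deleteArrows_append, deleteArrows_cons, haT, hbT, if_false,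
      deleteArrows_nil] at h1 h2 ⊢
    exact hV.move h1 h2 (Move.r2 _ _ _ a b e 1 hs)
  rw [allDashed, hAW, wordSemivirtual_insert _ _ hbS, wordSemivirtual_insert _ _ ha,
    wordSemivirtual_insert _ _ ha, hWS] at h1
  rw [allDashed, hAb, allDashed, hAa, wordSemivirtual_insert _ _ hb',
    wordSemivirtual_insert _ _ ha]
  simp only [hW, oriented, if_true, deleteArrows_append, deleteArrows_cons, hu, hu',
    deleteArrows_nil, Finset.mem_singleton, hab, hab.symm, if_false, List.append_nil] at h1 ⊢
  rw [← sub_eq_zero, ← neg_eq_zero, ← h1]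
  abel

theorem IsGaussWord.exists_eq {w : List Endpoint} (hw : IsGaussWord w) {a : Arrow}
    (ha : a ∈ wordArrows w) :
    ∃ u t s e, w = u ++ [⟨a, e⟩] ++ t ++ [⟨a, e.flip⟩] ++ s := by
  obtain ⟨⟨a, e⟩, hx, rfl⟩ := mem_wordArrows.1 ha
  have hf := hw.flip_mem _ hx
  obtain ⟨u, v, rfl⟩ := List.append_of_mem hx
  simp only [List.mem_append, List.mem_cons, Endpoint.flip_ne, false_or] at hf
  rcases hf with hf | hf
  · obtain ⟨u', t, rfl⟩ := List.append_of_mem hf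
    exact ⟨u', t, v, e.flip, by simp [Endpoint.flip]⟩
  · obtain ⟨t, s, rfl⟩ := List.append_of_mem hf
    exact ⟨u, t, s, e, by simp [Endpoint.flip]⟩

theorem allDashed_map_replaceArrow (hV : IsInvariant V) {w : List Endpoint} {a b : Arrow}
    (hs : a.sign = -b.sign) (hw : IsGaussWord w) (ha : a ∈ wordArrows w) (hb : b ∉ wordArrows w)
    (hN : ∀ w', IsGaussWord w' → (wordArrows w).card < (wordArrows w').card →
      allDashed V w' = 0) :
    allDashed V (w.map (replaceArrow a b)) = -allDashed V w := by
  obtain ⟨u, t, s, e, rfl⟩ := hw.exists_eq ha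
  have hp : List.Perm (u ++ [⟨a, e⟩] ++ t ++ [⟨a, e.flip⟩] ++ s)
      ((⟨a, e⟩ : Endpoint) :: (⟨a, e⟩ : Endpoint).flip :: (u ++ t ++ s)) := by
    rw [List.perm_iff_count]; intro y; simp [List.count_cons, Endpoint.flip]; omega
  have ha' : a ∉ wordArrows (u ++ t ++ s) := hw.arrow_notMem hp
  simp only [wordArrows_append, Finset.mem_union, not_or] at ha'
  rw [← allDashed_parallel hV hs hw hb hN]
  simp only [List.map_append, map_replaceArrow_eq_self ha'.1.1, map_replaceArrow_eq_self ha'.1.2,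
    map_replaceArrow_eq_self ha'.2]
  simp [replaceArrow]

/-- The relation between subdiagrams with two of three arrows dashed that follows from the third
Reidemeister move. -/
theorem allDashed_six_term {w w' : List Endpoint} {a b c : Arrow} {S : Finset Arrow}
    (ha : a ∉ S) (hb : b ∉ S) (hc : c ∉ S) (hab : a ≠ b) (hac : a ≠ c) (hbc : b ≠ c)
    (hA : wordArrows w = insert a (insert b (insert c S))) (hA' : wordArrows w' = wordArrows w)
    (h0 : allDashed V w = 0) (h0' : allDashed V w' = 0)
    (hS : wordSemivirtual V w S = wordSemivirtual V w' S)
    (hdab : deleteArrows {a, b} w = deleteArrows {a, b} w')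
    (hdac : deleteArrows {a, c} w = deleteArrows {a, c} w')
    (hdbc : deleteArrows {b, c} w = deleteArrows {b, c} w') :
    allDashed V (deleteArrows {a} w) + allDashed V (deleteArrows {b} w) +
        allDashed V (deleteArrows {c} w) =
      allDashed V (deleteArrows {a} w') + allDashed V (deleteArrows {b} w') +
        allDashed V (deleteArrows {c} w') := by
  have hb' : b ∉ insert c S := by simp [hb, hbc]
  have ha'c : a ∉ insert c S := by simp [ha, hac]
  have ha'b : a ∉ insert b S := by simp [ha, hab]
  have ha' : a ∉ insert b (insert c S) := by simp [ha, hab, hac]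
  have e1 : insert a (insert b (insert c S)) \ {a} = insert b (insert c S) := by
    rw [Finset.sdiff_singleton_eq_erase, Finset.erase_insert ha']
  have e2 : insert a (insert b (insert c S)) \ {b} = insert a (insert c S) := by
    rw [Finset.insert_comm, Finset.sdiff_singleton_eq_erase,
      Finset.erase_insert (by simp [hb, hbc, hab.symm])]
  have e3 : insert a (insert b (insert c S)) \ {c} = insert a (insert b S) := by
    rw [Finset.insert_comm b c, Finset.insert_comm a c, Finset.sdiff_singleton_eq_erase,
      Finset.erase_insert (by simp [hc, hbc.symm, hac.symm])]
  have p1 : ({b} ∪ {a} : Finset Arrow) = {a, b} := by ext; simp; tauto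
  have p2 : ({c} ∪ {a} : Finset Arrow) = {a, c} := by ext; simp; tauto
  have p3 : ({c} ∪ {b} : Finset Arrow) = {b, c} := by ext; simp; tauto
  have q1 : ({a} ∪ {b} : Finset Arrow) = {a, b} := rfl
  have q2 : ({a} ∪ {c} : Finset Arrow) = {a, c} := rfl
  have q3 : ({b} ∪ {c} : Finset Arrow) = {b, c} := rfl
  have r : ({a, c} ∪ {b} : Finset Arrow) = {a, b} ∪ {c} := by ext; simp; tauto
  have hd : deleteArrows ({a, b} ∪ {c}) w = deleteArrows ({a, b} ∪ {c}) w' := by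
    rw [← deleteArrows_deleteArrows, hdab, deleteArrows_deleteArrows]
  simp only [allDashed, wordArrows_deleteArrows, hA', hA, e1, e2, e3] at h0 h0' ⊢
  simp only [wordSemivirtual_insert _ _ ha', wordSemivirtual_insert _ _ ha'b,
    wordSemivirtual_insert _ _ ha'c, wordSemivirtual_insert _ _ hb',
    wordSemivirtual_insert _ _ hb,
    wordSemivirtual_insert _ _ hc, deleteArrows_deleteArrows, p1, p2, p3, q1, q2, q3, r]
    at h0 h0' ⊢
  -- Expand in `a`, `b`, `c` with `S` dashed. The terms with all three arrows agree by `hS`, and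
  -- those with at most one agree by the deletion hypotheses. Only the terms with exactly two arrows
  -- can differ, and the vanishing of both full expansions equates their sums.
  rw [hS] at h0
  simp only [hdab, hdac, hdbc, hd] at h0 ⊢
  rw [← sub_eq_zero]
  have h := sub_eq_zero.2 (h0'.trans h0.symm)
  rw [← h]
  abel

end Semivirtual

end VirtualKnots

namespace VirtualKnots

open GaussDiagram

/-! ### The third Reidemeister move in block form. -/

/-- The word in which the three words `B i`, `B j`, `B k` are inserted between the four words
`U 0`, `U 1`, `U 2`, `U 3`. -/
def blocks (U : Fin 4 → List Endpoint) (i j k : Fin 3) (B : Fin 3 → List Endpoint) :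
    List Endpoint :=
  U 0 ++ B i ++ U 1 ++ B j ++ U 2 ++ B k ++ U 3

section Blocks

variable {U : Fin 4 → List Endpoint} {i j k : Fin 3} {B : Fin 3 → List Endpoint}

theorem blocks_perm (h : [i, j, k].Perm [0, 1, 2]) :
    (blocks U i j k B).Perm ((U 0 ++ U 1 ++ U 2 ++ U 3) ++ (B 0 ++ B 1 ++ B 2)) := by
  have h1 : (B i ++ B j ++ B k).Perm (B 0 ++ B 1 ++ B 2) := by
    simpa using (h.map B).flatten
  refine List.Perm.trans ?_ (h1.append_left _)
  rw [List.perm_iff_count]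
  intro y
  simp only [blocks, List.count_append]
  omega

theorem deleteArrows_blocks (T : Finset Arrow) :
    deleteArrows T (blocks U i j k B) =
      blocks (fun m => deleteArrows T (U m)) i j k (fun m => deleteArrows T (B m)) := by
  simp [blocks]

theorem map_blocks (g : Endpoint → Endpoint) :
    (blocks U i j k B).map g =
      blocks (fun m => (U m).map g) i j k (fun m => (B m).map g) := by
  simp [blocks]

theorem move_blocks (h : [i, j, k].Perm [0, 1, 2]) {a b c : Arrow} {σ τ₁ τ₂ τ₃ : ℤˣ}
    (ha : a.sign = σ * τ₁ * τ₂) (hb : b.sign = σ * τ₁ * τ₃) (hc : c.sign = σ * τ₂ * τ₃)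
    (hp : List.Perm [B 0, B 1, B 2]
        [oriented τ₁ [⟨a, .tail⟩, ⟨b, .tail⟩],
         oriented τ₂ [⟨a, .head⟩, ⟨c, .tail⟩],
         oriented τ₃ [⟨b, .head⟩, ⟨c, .head⟩]]) :
    Move (blocks U i j k B) (blocks U i j k fun m => (B m).reverse) :=
  Move.r3 _ _ _ _ _ _ _ a b c σ τ₁ τ₂ τ₃ ha hb hc ((h.map B).trans hp)

end Blocks

theorem oriented_map (τ : ℤˣ) (l : List Endpoint) (g : Endpoint → Endpoint) :
    (oriented τ l).map g = oriented τ (l.map g) := by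
  by_cases h : τ = 1 <;> simp [oriented, h]

theorem deleteArrows_reverse (T : Finset Arrow) (l : List Endpoint) :
    deleteArrows T l.reverse = (deleteArrows T l).reverse := by
  simp [deleteArrows]

theorem deleteArrows_oriented (T : Finset Arrow) (τ : ℤˣ) (l : List Endpoint) :
    deleteArrows T (oriented τ l) = oriented τ (deleteArrows T l) := by
  by_cases h : τ = 1 <;> simp [oriented, h, deleteArrows_reverse]

theorem oriented_singleton (τ : ℤˣ) (x : Endpoint) : oriented τ [x] = [x] := by
  by_cases h : τ = 1 <;> simp [oriented, h]

theorem oriented_nil (τ : ℤˣ) : oriented τ [] = [] := by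
  by_cases h : τ = 1 <;> simp [oriented, h]

theorem oriented_perm (τ : ℤˣ) (l : List Endpoint) : (oriented τ l).Perm l := by
  by_cases h : τ = 1 <;> simp [oriented, h, List.reverse_perm]

/-- The endpoints on the three strands of a third Reidemeister move. The arrows `a` and `b` start
on the first strand, and the arrow `c` connects the two other strands. -/
def triangle (a b c : Arrow) (s : ArrowEnd) : Fin 3 → List Endpoint :=
  ![[⟨a, .tail⟩, ⟨b, .tail⟩], [⟨a, .head⟩, ⟨c, s⟩],
    oriented (a.sign * b.sign) [⟨b, .head⟩, ⟨c, s.flip⟩]]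

/-- The strand with both tails is on top, and either of the other two strands may be the middle one.
Swapping these two reverses `c` and negates its sign, while all positions of endpoints stay the
same. -/
theorem move_triangle {U : Fin 4 → List Endpoint} {i j k : Fin 3} (h : [i, j, k].Perm [0, 1, 2])
    {a b c : Arrow} {s : ArrowEnd}
    (hc : c.sign = b.sign ∧ s = .tail ∨ c.sign = -b.sign ∧ s = .head) :
    Move (blocks U i j k (triangle a b c s))
      (blocks U i j k fun m => (triangle a b c s m).reverse) := by
  have haa := Int.units_mul_self a.sign
  rcases hc with ⟨hc, rfl⟩ | ⟨hc, rfl⟩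
  · refine move_blocks h (a := a) (b := b) (c := c) (σ := a.sign) (τ₁ := 1) (τ₂ := 1)
      (τ₃ := a.sign * b.sign) (by simp) ?_ ?_ ?_
    · rw [mul_one, ← mul_assoc, haa, one_mul]
    · rw [mul_one, ← mul_assoc, haa, one_mul, hc]
    · simp [triangle, oriented, ArrowEnd.flip]
  -- Here the strand with the head of `b` is the middle one, so `a` and `b` trade roles. The top
  -- strand then meets its crossings in the opposite order, whence `τ₁ = -1` and the sign in `σ`.
  · refine move_blocks h (a := b) (b := a) (c := c) (σ := -a.sign) (τ₁ := -1)
      (τ₂ := a.sign * b.sign) (τ₃ := 1) ?_ (by simp) ?_ ?_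
    · rw [mul_neg_one, neg_neg, ← mul_assoc, haa, one_mul]
    · rw [mul_one, ← mul_assoc, neg_mul, haa, hc, neg_one_mul]
    · simpa [triangle, oriented, ArrowEnd.flip] using List.Perm.swap _ _ _

/-! ### Adjacent endpoints commute in top degree. -/

section Commute

variable {G : Type*} [AddCommGroup G] {V : List Endpoint → G}
  {U : Fin 4 → List Endpoint} {i j k : Fin 3}

/-- The arrows `a` and `b` of `triangle a b c s`, without `c`. -/
def corner (a b : Arrow) : Fin 3 → List Endpoint :=
  ![[⟨a, .tail⟩, ⟨b, .tail⟩], [⟨a, .head⟩], [⟨b, .head⟩]]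

theorem triangle_perm (h : [i, j, k].Perm [0, 1, 2]) (a b c : Arrow) (s : ArrowEnd) :
    (blocks U i j k (triangle a b c s)).Perm
      (⟨c, s⟩ :: Endpoint.flip ⟨c, s⟩ :: blocks U i j k (corner a b)) := by
  refine (blocks_perm h).trans (List.Perm.trans ?_ (((blocks_perm h).symm.cons _).cons _))
  rw [List.perm_iff_count]
  intro y
  simp only [triangle, corner, List.count_append, List.count_cons, Matrix.cons_val,
    (oriented_perm _ _).count_eq, List.count_nil, Endpoint.flip]
  omega

theorem triangle_reverse_perm (h : [i, j, k].Perm [0, 1, 2]) (a b c : Arrow) (s : ArrowEnd) :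
    (blocks U i j k (triangle a b c s)).Perm
      (blocks U i j k fun m => (triangle a b c s m).reverse) := by
  refine (blocks_perm h).trans (List.Perm.trans ?_ (blocks_perm h).symm)
  rw [List.perm_iff_count]
  intro y
  simp only [List.count_append, List.count_reverse]

theorem corner_perm (h : [i, j, k].Perm [0, 1, 2]) (a b : Arrow) :
    (blocks U i j k (corner a b)).Perm
      ([⟨a, .tail⟩, ⟨a, .head⟩, ⟨b, .tail⟩, ⟨b, .head⟩] ++ (U 0 ++ U 1 ++ U 2 ++ U 3)) := by
  refine (blocks_perm h).trans ?_
  rw [List.perm_iff_count]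
  intro y
  simp only [corner, List.count_append, List.count_cons, Matrix.cons_val, List.count_nil]
  omega

/-- This is `allDashed_six_term` for the two sides of a third Reidemeister move. They have one arrow
more than the corner, so `hN` applies to them; once two of the three arrows are deleted, no strand
has two endpoints of the triangle left to exchange. -/
theorem allDashed_triangle (hV : IsInvariant V) (h : [i, j, k].Perm [0, 1, 2])
    {a b c : Arrow} {s : ArrowEnd} (hab : a ≠ b)
    (hw : IsGaussWord (blocks U i j k (corner a b)))
    (hN : ∀ w', IsGaussWord w' →
      (wordArrows (blocks U i j k (corner a b))).card < (wordArrows w').card →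
      allDashed V w' = 0)
    (hcw : c ∉ wordArrows (blocks U i j k (corner a b)))
    (hc : c.sign = b.sign ∧ s = .tail ∨ c.sign = -b.sign ∧ s = .head) :
    allDashed V (deleteArrows {a} (blocks U i j k (triangle a b c s))) +
        allDashed V (deleteArrows {b} (blocks U i j k (triangle a b c s))) +
        allDashed V (blocks U i j k (corner a b)) =
      allDashed V (deleteArrows {a} (blocks U i j k fun m => (triangle a b c s m).reverse)) +
        allDashed V (deleteArrows {b} (blocks U i j k fun m => (triangle a b c s m).reverse)) +
        allDashed V (blocks U i j k fun m => (corner a b m).reverse) := by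
  set S := wordArrows (U 0 ++ U 1 ++ U 2 ++ U 3) with hS
  have hAw : wordArrows (blocks U i j k (corner a b)) = insert a (insert b S) := by
    rw [wordArrows_perm (corner_perm h a b)]; simp [hS]
  have haS : a ∉ S := by
    have := hw.arrow_notMem (x := ⟨a, .tail⟩) (corner_perm h a b)
    simpa [hab, hS] using this
  have hbS : b ∉ S := by
    have := hw.arrow_notMem (x := ⟨b, .tail⟩)
      (w := [⟨a, .tail⟩, ⟨a, .head⟩] ++ (U 0 ++ U 1 ++ U 2 ++ U 3))
      ((corner_perm h a b).trans (by
        rw [List.perm_iff_count]; intro y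
        simp only [List.count_append, List.count_cons, List.count_nil, Endpoint.flip,
          ArrowEnd.flip]
        omega))
    simpa [hab.symm, hS] using this
  simp only [hAw, Finset.mem_insert, not_or] at hcw
  obtain ⟨hca, hcb, hcS⟩ := hcw
  have hF : IsGaussWord (blocks U i j k (triangle a b c s)) :=
    (hw.insert (x := ⟨c, s⟩) (by simp [hAw, hca, hcb, hcS])).perm (triangle_perm h a b c s).symm
  have hF' := hF.perm (triangle_reverse_perm h a b c s)
  have hA : wordArrows (blocks U i j k (triangle a b c s)) = insert a (insert b (insert c S)) := by
    rw [wordArrows_perm (triangle_perm h a b c s)]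
    simp only [wordArrows_cons, Endpoint.flip, hAw]
    ext; simp; tauto
  have hA' := (wordArrows_perm (triangle_reverse_perm (U := U) h a b c s)).symm
  have hcard : (wordArrows (blocks U i j k (corner a b))).card <
      (wordArrows (blocks U i j k (triangle a b c s))).card := by
    rw [hA, hAw, Finset.insert_comm b c, Finset.insert_comm a c,
      Finset.card_insert_of_notMem (a := c) (by simp [hca, hcb, hcS])]
    omega
  have hU : ∀ T : Finset Arrow, Disjoint T S → ∀ m, deleteArrows T (U m) = U m := by
    intro T hT m
    apply deleteArrows_eq_self
    refine hT.mono_right ?_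
    intro x
    simp only [hS, wordArrows_append, Finset.mem_union]
    fin_cases m <;> simp <;> tauto
  have hdc := hU {c} (by simpa using hcS)
  have hdab := hU {a, b} (by simp [haS, hbS])
  have hdac := hU {a, c} (by simp [haS, hcS])
  have hdbc := hU {b, c} (by simp [hbS, hcS])
  have hc1 : ∀ m, deleteArrows {c} (triangle a b c s m) = corner a b m := by
    intro m
    fin_cases m <;>
      simp [triangle, corner, deleteArrows_oriented, deleteArrows_cons, Ne.symm hca, Ne.symm hcb,
        oriented_singleton]
  have key := allDashed_six_term (V := V) (w := blocks U i j k (triangle a b c s))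
    (w' := blocks U i j k fun m => (triangle a b c s m).reverse) haS hbS hcS hab (Ne.symm hca)
    (Ne.symm hcb) hA hA' (hN _ hF hcard) (hN _ hF' (by rwa [hA'])) ?_ ?_ ?_ ?_
  · simpa only [deleteArrows_blocks {c}, hdc, hc1, deleteArrows_reverse] using key
  · apply wordSemivirtual_congr
    intro T hT
    have haT : a ∉ T := fun h => haS (hT h)
    have hbT : b ∉ T := fun h => hbS (hT h)
    have hcT : c ∉ T := fun h => hcS (hT h)
    have h1 := hF.delete T
    have h2 := hF'.delete T
    have hB : ∀ m, deleteArrows T (triangle a b c s m) = triangle a b c s m := by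
      intro m
      fin_cases m <;> simp [triangle, deleteArrows_oriented, deleteArrows_cons, haT, hbT, hcT]
    simp only [deleteArrows_blocks, deleteArrows_reverse, hB] at h1 h2 ⊢
    exact hV.move h1 h2 (move_triangle h hc)
  all_goals
    simp only [deleteArrows_blocks, deleteArrows_reverse, hdab, hdac, hdbc]
    congr 1
    funext m
    fin_cases m <;>
      simp [triangle, deleteArrows_oriented, deleteArrows_cons, Ne.symm hca, Ne.symm hcb, hab,
        hab.symm, hca, hcb, oriented_singleton, oriented_nil]

/-- Apply `allDashed_triangle` with `c` and again with the opposite arrow `c'`. The terms containing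
the third arrow are negated from one relation to the other, so they cancel in the sum. -/
theorem allDashed_corner [IsAddTorsionFree G] (hV : IsInvariant V) (h : [i, j, k].Perm [0, 1, 2])
    {a b : Arrow} (hab : a ≠ b) (hw : IsGaussWord (blocks U i j k (corner a b)))
    (hN : ∀ w', IsGaussWord w' →
      (wordArrows (blocks U i j k (corner a b))).card < (wordArrows w').card →
      allDashed V w' = 0) :
    allDashed V (blocks U i j k (corner a b)) =
      allDashed V (blocks U i j k fun m => (corner a b m).reverse) := by
  -- The label is new, so arrows with this label and either sign are new; `c` and `c'` share it and
  -- differ only in sign.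
  obtain ⟨ℓ, hℓ⟩ := Infinite.exists_notMem_finset
    ((wordArrows (blocks U i j k (corner a b))).image Arrow.label)
  have hfresh : ∀ c : Arrow, c.label = ℓ → c ∉ wordArrows (blocks U i j k (corner a b)) :=
    fun c hc h => hℓ (hc ▸ Finset.mem_image_of_mem _ h)
  set c : Arrow := ⟨ℓ, b.sign⟩ with hc
  set c' : Arrow := ⟨ℓ, -b.sign⟩ with hc'
  have hcw := hfresh c rfl
  have hcw' := hfresh c' rfl
  have hcc : c' ≠ c := by
    intro h
    have hs : -b.sign = b.sign := congrArg Arrow.sign h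
    rcases Int.units_eq_one_or b.sign with h' | h' <;> rw [h'] at hs <;>
      exact absurd hs (by decide)
  have hmem : ∀ d : Arrow, d ∉ wordArrows (blocks U i j k (corner a b)) →
      d ≠ a ∧ d ≠ b ∧ ∀ m, d ∉ wordArrows (U m) := by
    intro d hd
    rw [wordArrows_perm (corner_perm h a b)] at hd
    simp only [wordArrows_append, wordArrows_cons, Finset.mem_union, Finset.mem_insert,
      not_or] at hd
    refine ⟨hd.1.1, hd.1.2.2.1, fun m => ?_⟩
    fin_cases m
    exacts [hd.2.1.1.1, hd.2.1.1.2, hd.2.1.2, hd.2.2]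
  obtain ⟨hca, hcb, hcU⟩ := hmem c hcw
  obtain ⟨hca', hcb', hcU'⟩ := hmem c' hcw'
  have hF : IsGaussWord (blocks U i j k (triangle a b c .tail)) :=
    (hw.insert (x := ⟨c, .tail⟩) hcw).perm (triangle_perm h a b c .tail).symm
  have hF' := hF.perm (triangle_reverse_perm h a b c .tail)
  have hA : wordArrows (blocks U i j k (triangle a b c .tail)) =
      insert c (wordArrows (blocks U i j k (corner a b))) := by
    rw [wordArrows_perm (triangle_perm h a b c .tail)]
    simp [Endpoint.flip]
  have hmap : ∀ m, ((triangle a b c .tail m).map (reverseEndpoint c)).map (replaceArrow c c') =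
      triangle a b c' .head m := by
    intro m
    fin_cases m <;>
      simp [triangle, oriented_map, reverseEndpoint, replaceArrow, Ne.symm hca, Ne.symm hcb,
        Endpoint.flip, ArrowEnd.flip]
  -- Once `d` is deleted, the word has as many arrows as the corner, so `hN` is strong enough for
  -- the sign rule of the second move; reversing `c` is free.
  have hneg : ∀ d, d = a ∨ d = b → ∀ F, (blocks U i j k (triangle a b c .tail)).Perm F →
      allDashed V (deleteArrows {d} ((F.map (reverseEndpoint c)).map (replaceArrow c c'))) =
        -allDashed V (deleteArrows {d} F) := by
    intro d hd F hp
    have hdc : c ≠ d ∧ c' ≠ d := by rcases hd with rfl | rfl <;> exact ⟨‹_›, ‹_›⟩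
    have hdw : d ∈ wordArrows (blocks U i j k (corner a b)) := by
      rw [wordArrows_perm (corner_perm h a b)]
      rcases hd with rfl | rfl <;> simp
    have hG := (hF.perm hp).delete {d}
    have hAF := wordArrows_perm hp
    have hcard : (wordArrows (deleteArrows {d} F)).card =
        (wordArrows (blocks U i j k (corner a b))).card := by
      rw [wordArrows_deleteArrows, ← hAF, hA, Finset.sdiff_singleton_eq_erase,
        Finset.card_erase_of_mem (Finset.mem_insert_of_mem hdw),
        Finset.card_insert_of_notMem hcw, Nat.add_sub_cancel]
    rw [deleteArrows_map, deleteArrows_map (by simp), allDashed_map_replaceArrow hV,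
      allDashed_map_reverse hV hG]
    · simp [hc, hc']
    · exact hG.map_reverse c
    · rw [wordArrows_map_reverse, wordArrows_deleteArrows, ← hAF, hA]
      simp [hdc.1]
    · rw [wordArrows_map_reverse, wordArrows_deleteArrows, ← hAF, hA]
      simp [hcc, hcw']
    · rwa [wordArrows_map_reverse, hcard]
    · intro x _
      by_cases hx : x.arrow = c
      · simp [replaceArrow, hx, hdc.1, hdc.2]
      · simp [replaceArrow, hx]
  have hUm : ∀ m, ((U m).map (reverseEndpoint c)).map (replaceArrow c c') = U m := by
    intro m
    rw [map_reverse_eq_self (hcU m), map_replaceArrow_eq_self (hcU m)]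
  have r1 := allDashed_triangle hV h hab hw hN hcw (.inl ⟨rfl, rfl⟩)
  have r2 := allDashed_triangle hV h hab hw hN hcw' (.inr ⟨rfl, rfl⟩)
  have e1 : blocks U i j k (triangle a b c' .head) =
      ((blocks U i j k (triangle a b c .tail)).map (reverseEndpoint c)).map
        (replaceArrow c c') := by
    simp only [map_blocks, hmap, hUm]
  have e2 : (blocks U i j k fun m => (triangle a b c' .head m).reverse) =
      ((blocks U i j k fun m => (triangle a b c .tail m).reverse).map (reverseEndpoint c)).map
        (replaceArrow c c') := by
    simp only [map_blocks, List.map_reverse, hmap, hUm]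
  have hp := triangle_reverse_perm (U := U) h a b c .tail
  rw [e1, e2, hneg a (.inl rfl) _ (List.Perm.refl _), hneg b (.inr rfl) _ (List.Perm.refl _),
    hneg a (.inl rfl) _ hp, hneg b (.inr rfl) _ hp] at r2
  -- The sum of `r1` and `r2` is twice the goal; here torsion-freeness enters.
  refine nsmul_right_injective two_ne_zero ?_
  simp only [two_nsmul]
  have r := congrArg₂ (· + ·) r1 r2
  rw [← sub_eq_zero] at r ⊢
  rw [← r]
  abel

/-- A decomposition of a Gauss word around two adjacent endpoints. -/
theorem exists_blocks {u v : List Endpoint} {x y : Endpoint}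
    (hw : IsGaussWord (u ++ [x, y] ++ v)) (hxy : x.arrow ≠ y.arrow) :
    ∃ (U : Fin 4 → List Endpoint) (i j k : Fin 3), [i, j, k].Perm [0, 1, 2] ∧
      u ++ [x, y] ++ v = blocks U i j k ![[x, y], [x.flip], [y.flip]] ∧
      u ++ [y, x] ++ v = blocks U i j k ![[y, x], [x.flip], [y.flip]] := by
  have hne : x.flip ≠ y ∧ y.flip ≠ x ∧ x.flip ≠ y.flip :=
    ⟨fun h => hxy (h ▸ rfl), fun h => hxy (h ▸ rfl),
      fun h => hxy (congrArg Endpoint.arrow h :)⟩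
  have hx := hw.flip_mem x (by simp)
  have hy := hw.flip_mem y (by simp)
  simp only [List.mem_append, List.mem_cons, Endpoint.flip_ne, hne, List.not_mem_nil,
    or_false] at hx hy
  -- There are six cases, the possible orders of the pair and the two opposite endpoints along the
  -- word.
  rcases hx with hx | hx <;> obtain ⟨s, t, rfl⟩ := List.append_of_mem hx <;>
    rcases hy with hy | hy <;>
    try simp only [List.mem_append, List.mem_cons, hne.2.2.symm, false_or] at hy
  · rcases hy with hy | hy <;> obtain ⟨p, q, rfl⟩ := List.append_of_mem hy
    · exact ⟨![p, q, t, v], 2, 1, 0, by decide, by simp [blocks], by simp [blocks]⟩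
    · exact ⟨![s, p, q, v], 1, 2, 0, by decide, by simp [blocks], by simp [blocks]⟩
  · obtain ⟨p, q, rfl⟩ := List.append_of_mem hy
    exact ⟨![s, t, p, q], 1, 0, 2, by decide, by simp [blocks], by simp [blocks]⟩
  · obtain ⟨p, q, rfl⟩ := List.append_of_mem hy
    exact ⟨![p, q, s, t], 2, 0, 1, by decide, by simp [blocks], by simp [blocks]⟩
  · rcases hy with hy | hy <;> obtain ⟨p, q, rfl⟩ := List.append_of_mem hy
    · exact ⟨![u, p, q, t], 0, 2, 1, by decide, by simp [blocks], by simp [blocks]⟩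
    · exact ⟨![u, s, p, q], 0, 1, 2, by decide, by simp [blocks], by simp [blocks]⟩

theorem allDashed_comm_tail [IsAddTorsionFree G] (hV : IsInvariant V) {u v : List Endpoint}
    {a b : Arrow} (hab : a ≠ b)
    (hw : IsGaussWord (u ++ [⟨a, .tail⟩, ⟨b, .tail⟩] ++ v))
    (hN : ∀ w', IsGaussWord w' →
      (wordArrows (u ++ [⟨a, .tail⟩, ⟨b, .tail⟩] ++ v)).card < (wordArrows w').card →
      allDashed V w' = 0) :
    allDashed V (u ++ [⟨a, .tail⟩, ⟨b, .tail⟩] ++ v) =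
      allDashed V (u ++ [⟨b, .tail⟩, ⟨a, .tail⟩] ++ v) := by
  obtain ⟨U, i, j, k, h, h1, h2⟩ := exists_blocks hw hab
  have e1 : (![[⟨a, .tail⟩, ⟨b, .tail⟩], [Endpoint.flip ⟨a, .tail⟩], [Endpoint.flip ⟨b, .tail⟩]] :
      Fin 3 → List Endpoint) = corner a b := rfl
  have e2 : (![[⟨b, .tail⟩, ⟨a, .tail⟩], [Endpoint.flip ⟨a, .tail⟩], [Endpoint.flip ⟨b, .tail⟩]] :
      Fin 3 → List Endpoint) = fun m => (corner a b m).reverse := by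
    funext m
    fin_cases m <;> rfl
  rw [e1] at h1
  rw [e2] at h2
  rw [h2]
  rw [h1] at hw hN ⊢
  exact allDashed_corner hV h hab hw hN

theorem allDashed_comm [IsAddTorsionFree G] (hV : IsInvariant V) {u v : List Endpoint}
    {x y : Endpoint} (hxy : x.arrow ≠ y.arrow) (hw : IsGaussWord (u ++ [x, y] ++ v))
    (hN : ∀ w', IsGaussWord w' →
      (wordArrows (u ++ [x, y] ++ v)).card < (wordArrows w').card → allDashed V w' = 0) :
    allDashed V (u ++ [x, y] ++ v) = allDashed V (u ++ [y, x] ++ v) := by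
  let P (u v : List Endpoint) (x y : Endpoint) : Prop :=
    IsGaussWord (u ++ [x, y] ++ v) →
    (∀ w', IsGaussWord w' →
      (wordArrows (u ++ [x, y] ++ v)).card < (wordArrows w').card → allDashed V w' = 0) →
    allDashed V (u ++ [x, y] ++ v) = allDashed V (u ++ [y, x] ++ v)
  -- Reversing `a` also flips its other endpoint, which may lie in `u` or `v`; so the hypothesis is
  -- needed for all contexts.
  have step (a : Arrow) (x y : Endpoint)
      (hP : ∀ u v, P u v (reverseEndpoint a x) (reverseEndpoint a y)) (u v : List Endpoint) :
      P u v x y := by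
    intro hw hN
    have hw' : IsGaussWord (u ++ [y, x] ++ v) :=
      hw.perm (((List.Perm.swap _ _ _).append_left u).append_right v)
    have h1 := hw.map_reverse a
    have h := hP (u.map (reverseEndpoint a)) (v.map (reverseEndpoint a))
    rw [← wordArrows_map_reverse a] at hN
    rw [← allDashed_map_reverse hV hw a, ← allDashed_map_reverse hV hw' a]
    simp only [P, List.map_append, List.map_cons, List.map_nil] at h h1 hN ⊢
    exact h h1 hN
  obtain ⟨a, e⟩ := x
  obtain ⟨b, f⟩ := y
  have hab : a ≠ b := hxy
  have h1 (u v : List Endpoint) : P u v ⟨a, .tail⟩ ⟨b, .tail⟩ := allDashed_comm_tail hV hab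
  have h2 (u v : List Endpoint) : P u v ⟨a, .tail⟩ ⟨b, f⟩ := by
    cases f with
    | tail => exact h1 u v
    | head =>
      refine step b _ _ ?_ u v
      simpa [reverseEndpoint, hab, Endpoint.flip, ArrowEnd.flip] using h1
  have h3 : P u v ⟨a, e⟩ ⟨b, f⟩ := by
    cases e with
    | tail => exact h2 u v
    | head =>
      refine step a _ _ ?_ u v
      simpa [reverseEndpoint, hab.symm, Endpoint.flip, ArrowEnd.flip] using h2
  exact h3 hw hN

/-! ### Descent on the number of arrows. -/

theorem allDashed_eq_zero_of_top [IsAddTorsionFree G] (hV : IsInvariant V) {N : ℕ} (hN0 : 0 < N)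
    (hN : ∀ w', IsGaussWord w' → N < (wordArrows w').card → allDashed V w' = 0)
    {w : List Endpoint} (hw : IsGaussWord w) (hwN : (wordArrows w).card = N) :
    allDashed V w = 0 := by
  -- Induction on the stretch `t` between the two ends of one arrow: each exchange moves the first
  -- letter of `t` out to the left, until the arrow is isolated.
  have key : ∀ (t u s : List Endpoint) (x : Endpoint),
      IsGaussWord (u ++ [x] ++ t ++ [x.flip] ++ s) →
      (wordArrows (u ++ [x] ++ t ++ [x.flip] ++ s)).card = N →
      allDashed V (u ++ [x] ++ t ++ [x.flip] ++ s) = 0 := by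
    intro t
    induction t with
    | nil =>
      intro u s x h _
      have := allDashed_isolated (u := u) (t := s) (x := x) hV (by simpa using h)
      simpa using this
    | cons y t ih =>
      intro u s x h hc
      have e1 : u ++ [x] ++ (y :: t) ++ [x.flip] ++ s = u ++ [x, y] ++ (t ++ [x.flip] ++ s) := by
        simp
      have e2 : u ++ [y, x] ++ (t ++ [x.flip] ++ s) = u ++ [y] ++ [x] ++ t ++ [x.flip] ++ s := by
        simp
      have hp : (u ++ [x, y] ++ (t ++ [x.flip] ++ s)).Perm
          (u ++ [y, x] ++ (t ++ [x.flip] ++ s)) :=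
        ((List.Perm.swap _ _ _).append_left u).append_right _
      have hxy : x.arrow ≠ y.arrow := by
        have hp : (u ++ [x] ++ (y :: t) ++ [x.flip] ++ s).Perm
            (x :: x.flip :: (u ++ (y :: t) ++ s)) := by
          rw [List.perm_iff_count]; intro y; simp [List.count_cons]; omega
        have := h.arrow_notMem hp
        simp only [wordArrows_append, wordArrows_cons, Finset.mem_union, Finset.mem_insert,
          not_or] at this
        exact this.1.2.1
      rw [e1] at h hc ⊢
      rw [allDashed_comm hV hxy h (by rwa [hc])]
      have h' := h.perm hp
      rw [wordArrows_perm hp] at hc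
      rw [e2] at hc h' ⊢
      exact ih (u ++ [y]) s x h' hc
  obtain ⟨a, ha⟩ := Finset.card_pos.1 (hwN ▸ hN0)
  obtain ⟨u, t, s, e, rfl⟩ := hw.exists_eq ha
  exact key t u s ⟨a, e⟩ hw hwN

theorem allDashed_eq_zero [IsAddTorsionFree G] (hV : IsInvariant V) {N : ℕ}
    (hN : ∀ w', IsGaussWord w' → N < (wordArrows w').card → allDashed V w' = 0) :
    ∀ w', IsGaussWord w' → 0 < (wordArrows w').card → allDashed V w' = 0 := by
  induction N with
  | zero => exact hN
  | succ N ih =>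
    refine ih fun w hw h => ?_
    rcases (Nat.succ_le_of_lt h).eq_or_lt with h | h
    · exact allDashed_eq_zero_of_top hV N.succ_pos hN hw h.symm
    · exact hN w hw h

/-- By strong induction on the number of arrows, every proper subdiagram already has the value `V
[]`. -/
theorem eq_nil_of_allDashed_eq_zero
    (h0 : ∀ w', IsGaussWord w' → 0 < (wordArrows w').card → allDashed V w' = 0)
    {w : List Endpoint} (hw : IsGaussWord w) : V w = V [] := by
  induction hn : (wordArrows w).card using Nat.strong_induction_on generalizing w with
  | _ n ih =>
    rcases Nat.eq_zero_or_pos n with rfl | hpos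
    · have h1 := deleteArrows_wordArrows w
      rw [Finset.card_eq_zero.1 hn, deleteArrows_eq_self (by simp)] at h1
      rw [h1]
    · have hne : (wordArrows w).Nonempty := Finset.card_pos.1 (hn ▸ hpos)
      -- Subtracting the constant `V []` is harmless, since the alternating sum of signs over the
      -- subsets of a nonempty set is zero. Afterwards only `T = ∅` contributes.
      have hsum : ∑ T ∈ (wordArrows w).powerset,
          (-1 : ℤ) ^ T.card • (V (deleteArrows T w) - V []) = 0 := by
        simp only [smul_sub, Finset.sum_sub_distrib, ← Finset.sum_smul]
        rw [Finset.sum_powerset_neg_one_pow_card_of_nonempty hne, zero_smul, sub_zero]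
        exact h0 w hw (hn ▸ hpos)
      rw [Finset.sum_eq_single_of_mem ∅ (Finset.empty_mem_powerset _)] at hsum
      · rw [deleteArrows_eq_self (by simp)] at hsum
        simpa [sub_eq_zero] using hsum
      · intro T hT hT0
        rw [ih _ ?_ (hw.delete T) rfl, sub_self, smul_zero]
        rw [wordArrows_deleteArrows, ← hn]
        exact Finset.card_lt_card (Finset.sdiff_ssubset (Finset.mem_powerset.1 hT)
          (Finset.nonempty_iff_ne_empty.2 hT0))

end Commute

/-! ### From words back to virtual knots. -/

open Classical in
/-- The extension by zero of a function of Gauss diagrams to all words. -/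
noncomputable def onWords {G : Type*} [AddCommGroup G] (v : GaussDiagram → G)
    (w : List Endpoint) : G :=
  if h : IsGaussWord w then v ⟨w, h.nodup, h.flip_mem⟩ else 0

theorem onWords_word {G : Type*} [AddCommGroup G] (v : GaussDiagram → G) (D : GaussDiagram) :
    onWords v D.word = v D :=
  dif_pos ⟨D.nodup, D.flip_mem⟩

/-- The common core of the round and the long case: invariants of either kind are functions of
diagrams that respect the moves on the line. -/
theorem eq_of_virtualization_invariant {G : Type*} [AddCommGroup G] [IsAddTorsionFree G]
    {v : GaussDiagram → G} {n : ℕ} (hn : VanishesAbove n v)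
    (hmove : ∀ D D' : GaussDiagram, Move D.word D'.word → v D = v D')
    (hrev : ∀ D : GaussDiagram, ∀ a ∈ D.arrows, v (D.reverseArrow a) = v D)
    (D D' : GaussDiagram) : v D = v D' := by
  have hV : IsInvariant (onWords v) := by
    refine ⟨fun {w w'} hw hw' hm => ?_, fun {w} a hw => ?_⟩
    · rw [onWords, onWords, dif_pos hw, dif_pos hw']
      exact hmove _ _ hm
    · by_cases ha : a ∈ wordArrows w
      · rw [onWords, onWords, dif_pos hw, dif_pos (hw.map_reverse a)]
        exact hrev ⟨w, hw.nodup, hw.flip_mem⟩ a ha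
      · rw [map_reverse_eq_self ha]
  have hN : ∀ w, IsGaussWord w → n < (wordArrows w).card → allDashed (onWords v) w = 0 := by
    intro w hw hc
    rw [← hn ⟨w, hw.nodup, hw.flip_mem⟩ (wordArrows w) subset_rfl hc, allDashed,
      wordSemivirtual, semivirtualValue]
    refine Finset.sum_congr rfl fun T _ => ?_
    rw [← onWords_word v (GaussDiagram.delete _ T)]
    rfl
  have h := fun D : GaussDiagram =>
    eq_nil_of_allDashed_eq_zero (allDashed_eq_zero hV hN) ⟨D.nodup, D.flip_mem⟩
  rw [← onWords_word v D, ← onWords_word v D', h D, h D']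

theorem VirtualKnot.eq_const {G : Type*} [AddCommGroup G] [IsAddTorsionFree G]
    {v : VirtualKnot → G} (hv : IsGPVFiniteType v)
    (h : ∀ K K', Virtualization K K' → v K = v K') : ∃ g : G, ∀ K, v K = g := by
  obtain ⟨n, hn⟩ := hv
  refine ⟨v (mk ⟨[], List.nodup_nil, by simp⟩), fun K => ?_⟩
  induction K using Quotient.inductionOn with
  | _ D =>
    refine eq_of_virtualization_invariant hn (fun D D' hm => ?_) (fun D a ha => ?_) D _
    · exact congrArg v (Quotient.sound (.rel _ _ (.inl hm)))
    · exact (h _ _ ⟨D, a, ha, rfl, rfl⟩).symm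

theorem LongVirtualKnot.eq_const {G : Type*} [AddCommGroup G] [IsAddTorsionFree G]
    {v : LongVirtualKnot → G} (hv : IsGPVFiniteType v)
    (h : ∀ K K', Virtualization K K' → v K = v K') : ∃ g : G, ∀ K, v K = g := by
  obtain ⟨n, hn⟩ := hv
  refine ⟨v (mk ⟨[], List.nodup_nil, by simp⟩), fun K => ?_⟩
  induction K using Quotient.inductionOn with
  | _ D =>
    refine eq_of_virtualization_invariant hn (fun D D' hm => ?_) (fun D a ha => ?_) D _
    · exact congrArg v (Quotient.sound (.rel _ _ hm))
    · exact (h _ _ ⟨D, a, ha, rfl, rfl⟩).symm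

end VirtualKnots

theorem theorem1 {G : Type*} [AddCommGroup G] [IsAddTorsionFree G] :
    (∀ v : VirtualKnots.VirtualKnot → G, VirtualKnots.VirtualKnot.IsGPVFiniteType v →
      ((∀ K K' : VirtualKnots.VirtualKnot,
          VirtualKnots.VirtualKnot.Virtualization K K' → v K = v K') →
        ∃ g : G, ∀ K, v K = g) ∧
      ((¬ ∃ g : G, ∀ K, v K = g) →
        ∃ K K' : VirtualKnots.VirtualKnot,
          VirtualKnots.VirtualKnot.Virtualization K K' ∧ v K ≠ v K')) ∧
    (∀ v : VirtualKnots.LongVirtualKnot → G, VirtualKnots.LongVirtualKnot.IsGPVFiniteType v →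
      ((∀ K K' : VirtualKnots.LongVirtualKnot,
          VirtualKnots.LongVirtualKnot.Virtualization K K' → v K = v K') →
        ∃ g : G, ∀ K, v K = g) ∧
      ((¬ ∃ g : G, ∀ K, v K = g) →
        ∃ K K' : VirtualKnots.LongVirtualKnot,
          VirtualKnots.LongVirtualKnot.Virtualization K K' ∧ v K ≠ v K')) := by
  refine ⟨fun v hv => ⟨fun h => VirtualKnots.VirtualKnot.eq_const hv h, fun hc => ?_⟩,
    fun v hv => ⟨fun h => VirtualKnots.LongVirtualKnot.eq_const hv h, fun hc => ?_⟩⟩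
  · by_contra! h
    exact hc (VirtualKnots.VirtualKnot.eq_const hv h)
  · by_contra! h
    exact hc (VirtualKnots.LongVirtualKnot.eq_const hv h)
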